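/- Let $G=(V,E)$ be a finite bipartite graph with parts $V_1,V_2$, let $h\ge 1$ be an integer and $n=|V|$. Number the vertices so that $V_1=\{v_1,\dots,v_s\}$, $V_2=\{v_{s+1},\dots,v_n\}$ and $j\ge i+3$ for every edge $\{v_i,v_j\}\in E$ with $i<j$. Put $y=10n^2$. "Joining two vertices by a path of length $m$" means adding a path of length $m$ between them whose $m-1$ inner vertices are new. Construct a graph $G'$ as follows. (a) *Skeleton.* Take vertices $u^t_1,\dots,u^t_n$ and $u^b_1,\dots,u^b_n$; for $1\le i<n$ join $u^t_i$ to $u^t_{i+1}$, and $u^b_i$ to $u^b_{i+1}$, by a path of length $y$. The path $u^t_1-\dots-u^t_n$ is the top-line. To each of $u^t_1,u^t_n,u^b_1,u^b_n$ attach a new path on three vertices by making its middle vertex adjacent to that vertex. (b) *Vertex gadgets.* For each $i\in\{1,\dots,n\}$ add a cycle $a^t_i-l^i_1-\dots-l^i_n-a^b_i-r^i_n-\dots-r^i_1-a^t_i$ of length $2n+2$; join $a^t_i$ to $u^t_i$ and $a^b_i$ to $u^b_i$ by paths of length $y$. (c) *Edge gadgets.* For each edge $\{v_i,v_j\}\in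 E$ with $i<j$ join $r^i_j$ to $r^j_i$ by a path of length $(j-i+\frac32)y$; let $w^{i,j}_1$ and $w^{i,j}_2$ be the vertices of this path at distance $y$ along it from $r^i_j$ and from $r^j_i$, respectively. Let $u^t_{i,j,1}$ (respectively $u^t_{i,j,2}$) be the vertex on the top-line between $u^t_i$ and $u^t_j$ at distance $j$ from $u^t_i$ (respectively at distance $i$ from $u^t_j$). Join $w^{i,j}_1$ to $u^t_{i,j,1}$ and $w^{i,j}_2$ to $u^t_{i,j,2}$ by paths of length $y$. A metric basis of a graph is a set $L$ of vertices such that for any two distinct vertices $u,w$ there is $x\in L$ with $\operatorname{dist}(x,u)\ne\operatorname{dist}(x,w)$. A dominating set of $G$ is a set $D\subseteq V$ that meets the closed neighbourhood $N[v]$ of every $v\in V$. If $G'$ has a metric basis of size at most $k=h+4$, then $G$ has a dominating set of size at most $h$. -/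

import Mathlib

namespace MetricDim

/-- `D` is a dominating set: every closed neighbourhood `N[x]` meets `D`. -/
def IsDominatingSet {V : Type*} (G : SimpleGraph V) (D : Finset V) : Prop :=
  ∀ x : V, ∃ d ∈ D, d = x ∨ G.Adj x d

/-- `L` is a metric basis: each pair of distinct vertices is separated by some vertex of `L`. -/
def IsMetricBasis {V : Type*} (G : SimpleGraph V) (L : Finset V) : Prop :=
  ∀ u w : V, u ≠ w → ∃ x ∈ L, G.dist x u ≠ G.dist x w

/-- `(G, h)` is a yes-instance of (Bipartite) Dominating Set. -/
def DominatingSetYes {V : Type*} (G : SimpleGraph V) (h : ℕ) : Prop :=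
  ∃ D : Finset V, D.card ≤ h ∧ IsDominatingSet G D

/-- `(G, k)` is a yes-instance of Metric Dimension. -/
def MetricDimensionYes {V : Type*} (G : SimpleGraph V) (k : ℕ) : Prop :=
  ∃ L : Finset V, L.card ≤ k ∧ IsMetricBasis G L

/-- The vertex at position `p` of a path of length `len` from `a` to `b`, whose inner vertices
are, in this order, `inner 0, inner 1, …`. -/
def pathPoint {W : Type*} (a b : W) (len : ℕ) (inner : Fin (len - 1) → W) (p : ℕ) : W :=
  if p = 0 then a
  else if hp : p - 1 < len - 1 then inner ⟨p - 1, hp⟩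
  else b

/-- `x` and `z` are consecutive on the path of length `len` from `a` to `b` with inner
vertices `inner`. -/
def PathStep {W : Type*} (a b : W) (len : ℕ) (inner : Fin (len - 1) → W) (x z : W) : Prop :=
  ∃ p < len, x = pathPoint a b len inner p ∧ z = pathPoint a b len inner (p + 1)

/-- The length `y = 10 n²` of a `y`-path. -/
def yLen (n : ℕ) : ℕ := 10 * n ^ 2

/-- The two lines of the skeletal structure, top and bottom. -/
inductive Line
  | t
  | b

/-- The two ends of a line, left and right. -/
inductive Side
  | l
  | r

/-- The edges `{v_i, v_j}` of `G`, each listed once, as the pair `(i, j)` with `i < j`.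
Here and below indices start at `0`: the vertex `v_i` of the usual numbering `1, …, n` is
`i - 1 : Fin n`. -/
def GEdge {n : ℕ} (G : SimpleGraph (Fin n)) : Type :=
  {e : Fin n × Fin n // G.Adj e.1 e.2 ∧ e.1 < e.2}

namespace GEdge

variable {n : ℕ} {G : SimpleGraph (Fin n)}

/-- The smaller index of an edge. -/
def i (e : GEdge G) : Fin n := e.1.1

/-- The larger index of an edge. -/
def j (e : GEdge G) : Fin n := e.1.2

/-- The length `(j - i + 3/2) y` of the path between `r^i_j` and `r^j_i` (`y` is even). -/
def len (e : GEdge G) : ℕ := (e.j.val - e.i.val) * yLen n + 3 * yLen n / 2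

end GEdge

/-- The vertices of the constructed graph. -/
inductive Vtx {n : ℕ} (G : SimpleGraph (Fin n)) : Type
  /-- the vertex at position `p` of the top- or bottom-line, counted from its left endpoint -/
  | line (c : Line) (p : Fin ((n - 1) * yLen n + 1))
  /-- the middle vertex of the `P₃` at an end of a line -/
  | mid (c : Line) (d : Side)
  /-- the two other vertices of the `P₃` at an end of a line -/
  | leaf (c : Line) (d : Side) (m : Bool)
  /-- the anchors `a^t_i`, `a^b_i` -/
  | anchor (c : Line) (i : Fin n)
  /-- the inner vertices of the `y`-path from `a^c_i` to `u^c_i` -/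
  | anchorInner (c : Line) (i : Fin n) (p : Fin (yLen n - 1))
  /-- the left-vertices `l^i_1, …, l^i_n` -/
  | left (i : Fin n) (j : Fin n)
  /-- the right-vertices `r^i_1, …, r^i_n` -/
  | right (i : Fin n) (j : Fin n)
  /-- the inner vertices of the path from `r^i_j` to `r^j_i` in an edge-gadget -/
  | edgeInner (e : GEdge G) (p : Fin (e.len - 1))
  /-- the inner vertices of the `y`-path from `w^{i,j}_1` to `u^t_{i,j,1}` -/
  | tlInner (e : GEdge G) (p : Fin (yLen n - 1))
  /-- the inner vertices of the `y`-path from `w^{i,j}_2` to `u^t_{i,j,2}` -/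
  | trInner (e : GEdge G) (p : Fin (yLen n - 1))

theorem mul_yLen_lt {n : ℕ} (i : Fin n) : i.val * yLen n < (n - 1) * yLen n + 1 :=
  Nat.lt_succ_of_le (Nat.mul_le_mul_right _ (Nat.le_sub_one_of_lt i.isLt))

theorem GEdge.pos_lt {n : ℕ} {G : SimpleGraph (Fin n)} (e : GEdge G) :
    e.i.val * yLen n + (e.j.val + 1) < (n - 1) * yLen n + 1 := by
  have hij : e.i.val < e.j.val := e.2.2
  have hj : e.j.val < n := e.j.isLt
  have hy : n ≤ yLen n := by unfold yLen; nlinarith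
  have h1 : (e.i.val + 1) * yLen n ≤ (n - 1) * yLen n := Nat.mul_le_mul_right _ (by omega)
  rw [Nat.add_mul] at h1
  omega

namespace Vtx

variable {n : ℕ} {G : SimpleGraph (Fin n)}

/-- The vertex `u^t_i` or `u^b_i`. -/
def u (c : Line) (i : Fin n) : Vtx G := line c ⟨i.val * yLen n, mul_yLen_lt i⟩

/-- The endpoints of a line: `u^c_1` on the left and `u^c_n` on the right. -/
def endpoint (c : Line) : Side → Vtx G
  | .l => line c 0
  | .r => line c (Fin.last _)

/-- The vertex `u^t_{i,j,1}` of the top-line, between `u^t_i` and `u^t_j`, at distance `j`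
(in the numbering from `1`) from `u^t_i`. -/
def u1 (e : GEdge G) : Vtx G :=
  line .t ⟨e.i.val * yLen n + (e.j.val + 1), e.pos_lt⟩

/-- The vertex `u^t_{i,j,2}` of the top-line, between `u^t_i` and `u^t_j`, at distance `i`
(in the numbering from `1`) from `u^t_j`. -/
def u2 (e : GEdge G) : Vtx G :=
  line .t ⟨e.j.val * yLen n - (e.i.val + 1),
    lt_of_le_of_lt (Nat.sub_le _ _) (mul_yLen_lt e.j)⟩

/-- The vertex at position `p` of the path from `r^i_j` to `r^j_i`. -/
def edgePoint (e : GEdge G) (p : ℕ) : Vtx G :=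
  pathPoint (right e.i e.j) (right e.j e.i) e.len (edgeInner e) p

/-- The vertex `w^{i,j}_1`, at distance `y` from `r^i_j` on that path. -/
def w1 (e : GEdge G) : Vtx G := edgePoint e (yLen n)

/-- The vertex `w^{i,j}_2`, at distance `y` from `r^j_i` on that path. -/
def w2 (e : GEdge G) : Vtx G := edgePoint e (e.len - yLen n)

end Vtx

/-- The edges of the constructed graph, each given in one orientation. -/
inductive Step {n : ℕ} (G : SimpleGraph (Fin n)) : Vtx G → Vtx G → Prop
  /-- consecutive vertices of the top- or bottom-line -/
  | line (c : Line) (p q : Fin ((n - 1) * yLen n + 1)) (hpq : p.val + 1 = q.val) :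
      Step G (.line c p) (.line c q)
  /-- an endpoint is adjacent to the middle vertex of its `P₃` -/
  | mid (c : Line) (d : Side) : Step G (.endpoint c d) (.mid c d)
  /-- the two edges of a `P₃` -/
  | leaf (c : Line) (d : Side) (m : Bool) : Step G (.mid c d) (.leaf c d m)
  /-- the `y`-path from the anchor `a^c_i` to `u^c_i` -/
  | anchor (c : Line) (i : Fin n) (x z : Vtx G)
      (hs : PathStep (.anchor c i) (.u c i) (yLen n) (.anchorInner c i) x z) : Step G x z
  /-- the left half `a^t_i - l^i_1 - … - l^i_n - a^b_i` of the cycle -/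
  | left (i : Fin n) (x z : Vtx G)
      (hs : PathStep (.anchor .t i) (.anchor .b i) (n + 1) (.left i) x z) : Step G x z
  /-- the right half `a^t_i - r^i_1 - … - r^i_n - a^b_i` of the cycle -/
  | right (i : Fin n) (x z : Vtx G)
      (hs : PathStep (.anchor .t i) (.anchor .b i) (n + 1) (.right i) x z) : Step G x z
  /-- the path from `r^i_j` to `r^j_i` of an edge-gadget -/
  | edge (e : GEdge G) (x z : Vtx G)
      (hs : PathStep (.right e.i e.j) (.right e.j e.i) e.len (.edgeInner e) x z) : Step G x z
  /-- the `y`-path from `w^{i,j}_1` to `u^t_{i,j,1}` -/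
  | tl (e : GEdge G) (x z : Vtx G)
      (hs : PathStep (.w1 e) (.u1 e) (yLen n) (.tlInner e) x z) : Step G x z
  /-- the `y`-path from `w^{i,j}_2` to `u^t_{i,j,2}` -/
  | tr (e : GEdge G) (x z : Vtx G)
      (hs : PathStep (.w2 e) (.u2 e) (yLen n) (.trInner e) x z) : Step G x z

/-- The graph `G'` constructed from the graph `G` on `{v_1, …, v_n}`. -/
def reductionGraph {n : ℕ} (G : SimpleGraph (Fin n)) : SimpleGraph (Vtx G) :=
  SimpleGraph.fromRel (Step G)

end MetricDim

/-!
For each vertex `v_i`, some vertex of a metric basis has to separate `l^i_1` from `r^i_1`. Folding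
the left half of the cycle onto the right half shows that a vertex `x` outside the left half is at
least as close to `r^i_1` as to `l^i_1`. It is strictly closer only if every geodesic from `x` to
`r^i_1` avoids the anchors of `i`, hence arrives through an edge gadget at `v_i`. Entering that
edge gadget from the top-line is never shorter than walking along the top-line to `u^t_i`, so `x`
lies in the edge gadget or the geodesic comes from the vertex gadget of a neighbour `v_k`; and a
geodesic entering that vertex gadget from outside is again no shorter than one along the skeleton,
so then `x` belongs to the gadget of `v_k`. Thus the vertices `v_k` whose gadgets meet the basis
form a dominating set. The four `P₃`s each use up one vertex of the basis, because their two outer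
vertices are twins.
-/

namespace MetricDim

section Distances

variable {W W' : Type*} {H : SimpleGraph W} {H' : SimpleGraph W'}

theorem edist_le_natCast_of_add_le {x z b : W} {k m r : ℕ} (h₁ : H.edist x z ≤ k)
    (h₂ : H.edist z b ≤ m) (hr : k + m ≤ r) : H.edist x b ≤ r :=
  calc H.edist x b ≤ H.edist x z + H.edist z b := SimpleGraph.edist_triangle
    _ ≤ k + m := add_le_add h₁ h₂
    _ ≤ r := mod_cast hr

theorem dist_eq_of_edist_eq {x a b : W} (h : H.edist x a = H.edist x b) :
    H.dist x a = H.dist x b :=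
  congrArg ENat.toNat h

theorem edist_map_le {φ : W → W'} (hφ : ∀ x z, H.Adj x z → H'.edist (φ x) (φ z) ≤ 1) (x a : W) :
    H'.edist (φ x) (φ a) ≤ H.edist x a := by
  refine le_iInf fun p => ?_
  induction p with
  | nil => simp
  | @cons x z a h p ih =>
    calc H'.edist (φ x) (φ a) ≤ H'.edist (φ x) (φ z) + H'.edist (φ z) (φ a) :=
          SimpleGraph.edist_triangle
      _ ≤ 1 + p.length := add_le_add (hφ x z h) ih
      _ = (SimpleGraph.Walk.cons h p).length := by simp [add_comm]

theorem edist_le_dist_of_chain {g : ℕ → W} {len : ℕ}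
    (hg : ∀ p < len, H.edist (g p) (g (p + 1)) ≤ 1) {p q : ℕ} (hp : p ≤ len) (hq : q ≤ len) :
    H.edist (g p) (g q) ≤ Nat.dist p q := by
  wlog hpq : p ≤ q generalizing p q
  · rw [SimpleGraph.edist_comm, Nat.dist_comm]
    exact this hq hp (le_of_not_ge hpq)
  rw [Nat.dist_eq_sub_of_le hpq]
  induction q, hpq using Nat.le_induction with
  | base => simp
  | succ q hpq ih => exact edist_le_natCast_of_add_le (ih (by lia)) (hg q hq) (by lia)

/-- Think of `Z x m` as saying that `x` is reached inside a region within `m` steps, and of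
`E x m` as saying that the region is left at `x` after `m` steps. Both ways along the edge `xz`, the
next vertex is reached, or the region is left there. -/
def AdvancesOrExits (Z E : W → ℕ → Prop) (x z : W) : Prop :=
  ∀ m, (Z x m → Z z (m + 1) ∨ E z (m + 1)) ∧ (Z z m → Z x (m + 1) ∨ E x (m + 1))

theorem AdvancesOrExits.symm {Z E : W → ℕ → Prop} {x z : W} (h : AdvancesOrExits Z E x z) :
    AdvancesOrExits Z E z x :=
  fun m => (h m).symm

theorem advancesOrExits_of_not {Z E : W → ℕ → Prop} {x z : W} (hx : ∀ m, ¬ Z x m)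
    (hz : ∀ m, ¬ Z z m) : AdvancesOrExits Z E x z :=
  fun m => ⟨fun h => (hx m h).elim, fun h => (hz m h).elim⟩

theorem reached_or_exists_exit {Z E : W → ℕ → Prop}
    (hZ : ∀ x z, H.Adj x z → AdvancesOrExits Z E x z) {x a : W} (ha : Z a 0) (p : H.Walk x a) :
    Z x p.length ∨ ∃ z m, E z m ∧ H.edist x z + m ≤ p.length := by
  induction p with
  | nil => exact Or.inl ha
  | @cons x z a h p ih =>
    rcases ih ha with hz | ⟨z', m, hE, hm⟩
    · exact (((hZ x z h) p.length).2 hz).imp_right fun hE => ⟨x, p.length + 1, hE, by simp⟩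
    · refine Or.inr ⟨z', m, hE, ?_⟩
      calc H.edist x z' + m ≤ H.edist x z + H.edist z z' + m := by
            gcongr
            exact SimpleGraph.edist_triangle
        _ = 1 + (H.edist z z' + m) := by rw [SimpleGraph.edist_eq_one_iff_adj.2 h, add_assoc]
        _ ≤ 1 + p.length := by gcongr
        _ = (SimpleGraph.Walk.cons h p).length := by simp [add_comm]

end Distances

section Paths

variable {W W' : Type*} {a b : W} {len : ℕ} {inner : Fin (len - 1) → W}

@[simp]
theorem pathPoint_zero : pathPoint a b len inner 0 = a := by
  simp [pathPoint]

theorem pathPoint_len (h : 1 ≤ len) : pathPoint a b len inner len = b := by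
  simp [pathPoint, Nat.ne_zero_of_lt h]

theorem pathPoint_inner (p : Fin (len - 1)) :
    pathPoint a b len inner (p.val + 1) = inner p := by
  simp [pathPoint]

theorem map_pathPoint (φ : W → W') (p : ℕ) :
    φ (pathPoint a b len inner p) = pathPoint (φ a) (φ b) len (φ ∘ inner) p := by
  unfold pathPoint
  split_ifs <;> rfl

theorem PathStep.map (φ : W → W') {x z : W} (hs : PathStep a b len inner x z) :
    PathStep (φ a) (φ b) len (φ ∘ inner) (φ x) (φ z) := by
  obtain ⟨p, hp, rfl, rfl⟩ := hs
  exact ⟨p, hp, map_pathPoint φ p, map_pathPoint φ (p + 1)⟩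

theorem pathPoint_iff {Z : W → ℕ → Prop} {Q : ℕ → ℕ → Prop} (h0 : ∀ m, Z a m ↔ Q 0 m)
    (hlen : ∀ m, Z b m ↔ Q len m) (hinner : ∀ (p : Fin (len - 1)) m, Z (inner p) m ↔ Q (p + 1) m)
    (p : ℕ) (hp : p ≤ len) (m : ℕ) : Z (pathPoint a b len inner p) m ↔ Q p m := by
  rcases Nat.eq_zero_or_pos p with rfl | hpos
  · rw [pathPoint_zero, h0]
  · rcases hp.eq_or_lt with rfl | hlt
    · rw [pathPoint_len hpos, hlen]
    · obtain ⟨p, rfl⟩ := Nat.exists_eq_add_of_le' hpos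
      rw [pathPoint_inner ⟨p, by lia⟩, hinner]

theorem PathStep.advancesOrExits {Z E : W → ℕ → Prop} (Q : ℕ → ℕ → Prop)
    (hZ : ∀ p ≤ len, ∀ m, Z (pathPoint a b len inner p) m ↔ Q p m)
    (hQ : ∀ p q m, q ≤ len → p ≤ q + 1 → q ≤ p + 1 → Q p m →
      Q q (m + 1) ∨ E (pathPoint a b len inner q) (m + 1))
    {x z : W} (hs : PathStep a b len inner x z) : AdvancesOrExits Z E x z := by
  obtain ⟨p, hp, rfl, rfl⟩ := hs
  intro m
  rw [hZ p hp.le, hZ p hp.le, hZ (p + 1) hp, hZ (p + 1) hp]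
  exact ⟨hQ p (p + 1) m hp (by lia) le_rfl, hQ (p + 1) p m hp.le le_rfl (by lia)⟩

theorem PathStep.advancesOrExits_of_not {Z E : W → ℕ → Prop} (ha : ∀ m, ¬ Z a m)
    (hb : ∀ m, ¬ Z b m) (hinner : ∀ p m, ¬ Z (inner p) m) {x z : W}
    (hs : PathStep a b len inner x z) : AdvancesOrExits Z E x z :=
  hs.advancesOrExits (fun _ _ => False)
    (pathPoint_iff (fun m => iff_false_intro (ha m)) (fun m => iff_false_intro (hb m))
      fun p m => iff_false_intro (hinner p m))
    fun _ _ _ _ _ _ => False.elim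

end Paths

variable {n : ℕ} {G : SimpleGraph (Fin n)}

theorem edist_le_one_of_step {x z : Vtx G} (h : Step G x z) :
    (reductionGraph G).edist x z ≤ 1 := by
  rw [SimpleGraph.edist_le_one_iff_adj_or_eq, reductionGraph, SimpleGraph.fromRel_adj]
  tauto

theorem edist_map_le_of_step {φ : Vtx G → Vtx G} (hφ : ∀ x z, Step G x z → Step G (φ x) (φ z))
    (x a : Vtx G) : (reductionGraph G).edist (φ x) (φ a) ≤ (reductionGraph G).edist x a := by
  refine edist_map_le (fun x z h => ?_) x a
  rcases h.2 with hs | hs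
  · exact edist_le_one_of_step (hφ _ _ hs)
  · rw [SimpleGraph.edist_comm]
    exact edist_le_one_of_step (hφ _ _ hs)

theorem advancesOrExits_of_adj {Z E : Vtx G → ℕ → Prop}
    (hZ : ∀ x z, Step G x z → AdvancesOrExits Z E x z) (x z : Vtx G)
    (h : (reductionGraph G).Adj x z) : AdvancesOrExits Z E x z :=
  h.2.elim (hZ x z) fun hs => (hZ z x hs).symm

theorem edist_pathPoint_le {a b : Vtx G} {len : ℕ} {inner : Fin (len - 1) → Vtx G}
    (hs : ∀ x z, PathStep a b len inner x z → Step G x z) {p q : ℕ} (hp : p ≤ len) (hq : q ≤ len) :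
    (reductionGraph G).edist (pathPoint a b len inner p) (pathPoint a b len inner q)
      ≤ Nat.dist p q :=
  edist_le_dist_of_chain (fun p hp => edist_le_one_of_step (hs _ _ ⟨p, hp, rfl, rfl⟩)) hp hq

theorem edist_path_ends_le {a b : Vtx G} {len : ℕ} {inner : Fin (len - 1) → Vtx G}
    (hs : ∀ x z, PathStep a b len inner x z → Step G x z) (h : 1 ≤ len) :
    (reductionGraph G).edist a b ≤ len := by
  simpa [pathPoint_len h, Nat.dist_zero_left] using edist_pathPoint_le hs (Nat.zero_le len) le_rfl

theorem edist_line_le (c : Line) (p q : Fin ((n - 1) * yLen n + 1)) :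
    (reductionGraph G).edist (.line c p) (.line c q) ≤ Nat.dist p q := by
  have chain : ∀ k < (n - 1) * yLen n, (reductionGraph G).edist
      (.line c (Fin.ofNat ((n - 1) * yLen n + 1) k))
      (.line c (Fin.ofNat ((n - 1) * yLen n + 1) (k + 1))) ≤ 1 := fun k hk =>
    edist_le_one_of_step <| .line c _ _ <| by
      simp only [Fin.val_ofNat]
      rw [Nat.mod_eq_of_lt (by lia), Nat.mod_eq_of_lt (by lia)]
  simpa using edist_le_dist_of_chain chain p.is_le q.is_le

theorem two_mul_lt_yLen_half (hn : 0 < n) : 2 * n < yLen n / 2 := by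
  have h : yLen n / 2 = 5 * n ^ 2 := by unfold yLen; lia
  rw [h]
  nlinarith

theorem two_mul_yLen_half (n : ℕ) : 2 * (yLen n / 2) = yLen n := by
  unfold yLen
  lia

/-- The other side. -/
def Side.opp : Side → Side
  | .l => .r
  | .r => .l

theorem Side.exists {P : Side → Prop} : (∃ s, P s) ↔ P .l ∨ P .r :=
  ⟨fun ⟨s, h⟩ => by cases s; exacts [.inl h, .inr h], fun h => h.elim (⟨_, ·⟩) (⟨_, ·⟩)⟩

namespace GEdge

/-- The end of an edge on a given side; the left end is the one of smaller index. -/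
def tip (e : GEdge G) : Side → Fin n
  | .l => e.i
  | .r => e.j

/-- The distance, along the path of length `e.len`, from the end on side `s` to the vertex at
position `p`. Conversely, `e.pos s d` is the position at distance `d` from that end. -/
def pos (e : GEdge G) (s : Side) (p : ℕ) : ℕ :=
  match s with
  | .l => p
  | .r => e.len - p

theorem adj_tip (e : GEdge G) (s : Side) : G.Adj (e.tip s) (e.tip s.opp) := by
  cases s
  exacts [e.2.1, e.2.1.symm]

theorem len_eq (e : GEdge G) (s : Side) :
    e.len = Nat.dist (e.tip s) (e.tip s.opp) * yLen n + 3 * yLen n / 2 := by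
  have hlt : e.i.val < e.j.val := e.2.2
  cases s
  · simp only [len, tip, Side.opp, Nat.dist_eq_sub_of_le hlt.le]
  · simp only [len, tip, Side.opp, Nat.dist_eq_sub_of_le_right hlt.le]

theorem two_mul_yLen_lt_len (e : GEdge G) : 2 * yLen n < e.len := by
  have hy := two_mul_yLen_half n
  have hn := two_mul_lt_yLen_half e.i.pos
  have hlt : e.i.val < e.j.val := e.2.2
  have h : 1 * yLen n ≤ (e.j.val - e.i.val) * yLen n := Nat.mul_le_mul_right _ (by lia)
  rw [len]
  lia

theorem pos_pos (e : GEdge G) (s : Side) {p : ℕ} (hp : p ≤ e.len) : e.pos s (e.pos s p) = p := by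
  cases s <;> simp only [pos]
  lia

theorem pos_le (e : GEdge G) (s : Side) {p : ℕ} (hp : p ≤ e.len) : e.pos s p ≤ e.len := by
  cases s <;> simp only [pos] <;> lia

theorem pos_le_succ (e : GEdge G) (s : Side) {p q : ℕ} (hpq : p ≤ q + 1) (hqp : q ≤ p + 1) :
    e.pos s q ≤ e.pos s p + 1 := by
  cases s <;> simp only [pos] <;> lia

end GEdge

namespace Vtx

/-- The vertex `l^i_1`. Whatever separates it from `r^i_1` is charged to `v_i` or a neighbour. -/
def firstLeft (i : Fin n) : Vtx G := left i ⟨0, i.pos⟩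

/-- The vertex `r^i_1`, from which `ownZone i` is explored. -/
def firstRight (i : Fin n) : Vtx G := right i ⟨0, i.pos⟩

/-- The end of the path of an edge gadget on side `s`: `r^i_j` on the left, `r^j_i` on the
right. -/
def edgeEnd (e : GEdge G) (s : Side) : Vtx G := right (e.tip s) (e.tip s.opp)

/-- The branching points of an edge gadget: `w^{i,j}_1` on the left, `w^{i,j}_2` on the right. -/
def w (e : GEdge G) (s : Side) : Vtx G := edgePoint e (e.pos s (yLen n))

/-- The vertices where an edge gadget meets the top-line: `u^t_{i,j,1}` on the left,
`u^t_{i,j,2}` on the right. -/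
def top (e : GEdge G) : Side → Vtx G
  | .l => u1 e
  | .r => u2 e

/-- The inner vertices of the path from `w e s` to `top e s`. -/
def spurInner (e : GEdge G) : Side → Fin (yLen n - 1) → Vtx G
  | .l => tlInner e
  | .r => trInner e

theorem edgePoint_pos_zero (e : GEdge G) (s : Side) : edgePoint e (e.pos s 0) = edgeEnd e s := by
  cases s
  · exact pathPoint_zero
  · exact pathPoint_len (by have := e.two_mul_yLen_lt_len; lia)

theorem edgePoint_pos_len (e : GEdge G) (s : Side) :
    edgePoint e (e.pos s e.len) = edgeEnd e s.opp := by
  cases s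
  · exact edgePoint_pos_zero e .r
  · simpa [GEdge.pos, Side.opp] using edgePoint_pos_zero e .l

theorem edgePoint_iff {Z : Vtx G → ℕ → Prop} {Q : ℕ → ℕ → Prop} (e : GEdge G)
    (hend : ∀ s m, Z (edgeEnd e s) m ↔ Q (e.pos s 0) m)
    (hinner : ∀ (p : Fin (e.len - 1)) m, Z (edgeInner e p) m ↔ Q (p + 1) m) :
    ∀ p ≤ e.len, ∀ m, Z (edgePoint e p) m ↔ Q p m :=
  pathPoint_iff (hend .l) (hend .r) hinner

end Vtx

theorem Step.spur (e : GEdge G) (s : Side) (x z : Vtx G)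
    (hs : PathStep (.w e s) (.top e s) (yLen n) (.spurInner e s) x z) : Step G x z := by
  cases s
  · exact .tl e x z hs
  · exact .tr e x z hs

section SkeletonDistances

variable (i : Fin n)

theorem pathPoint_left_one :
    pathPoint (.anchor .t i) (.anchor .b i) (n + 1) (.left i) 1 = (Vtx.firstLeft i : Vtx G) :=
  pathPoint_inner (len := n + 1) ⟨0, i.pos⟩

theorem edist_anchor_t_firstLeft_le :
    (reductionGraph G).edist (.anchor .t i) (.firstLeft i) ≤ (1 : ℕ) := by
  have h := edist_pathPoint_le (Step.left (G := G) i) (p := 0) (q := 1) (by lia) (by lia)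
  rwa [pathPoint_zero, pathPoint_left_one, Nat.dist_zero_left] at h

theorem edist_anchor_b_firstLeft_le :
    (reductionGraph G).edist (.anchor .b i) (.firstLeft i) ≤ n := by
  have h := edist_pathPoint_le (Step.left (G := G) i) (p := n + 1) (q := 1) le_rfl (by lia)
  rwa [pathPoint_len (by lia), pathPoint_left_one, Nat.dist_eq_sub_of_le_right (by lia)] at h

theorem edist_anchor_firstLeft_le (c : Line) :
    (reductionGraph G).edist (.anchor c i) (.firstLeft i) ≤ n := by
  cases c
  · exact (edist_anchor_t_firstLeft_le i).trans (mod_cast i.pos)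
  · exact edist_anchor_b_firstLeft_le i

theorem edist_u_firstLeft_le (c : Line) (k : Fin n) :
    (reductionGraph G).edist (.u c k) (.firstLeft i)
      ≤ (Nat.dist i k * yLen n + yLen n + n : ℕ) := by
  have line : (reductionGraph G).edist (.u c k) (.u c i) ≤ (Nat.dist i k * yLen n : ℕ) := by
    rw [Nat.dist_comm, ← Nat.dist_mul_right]
    exact edist_line_le c _ _
  have down : (reductionGraph G).edist (.u c i) (.anchor c i) ≤ yLen n := by
    rw [SimpleGraph.edist_comm]
    exact edist_path_ends_le (Step.anchor c i) (by have := two_mul_lt_yLen_half i.pos; lia)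
  exact edist_le_natCast_of_add_le (edist_le_natCast_of_add_le line down le_rfl)
    (edist_anchor_firstLeft_le i c) le_rfl

theorem edist_top_u_le (e : GEdge G) (s : Side) :
    (reductionGraph G).edist (.top e s) (.u .t (e.tip s)) ≤ n := by
  have hi := e.i.isLt
  have hj := e.j.isLt
  cases s
  all_goals
    refine (edist_line_le .t _ _).trans ?_
    simp only [Nat.dist, GEdge.tip, Nat.cast_le]
    lia

theorem edist_top_firstLeft_le (e : GEdge G) (s : Side) :
    (reductionGraph G).edist (.top e s) (.firstLeft i)
      ≤ (Nat.dist i (e.tip s) * yLen n + yLen n + 2 * n : ℕ) :=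
  edist_le_natCast_of_add_le (edist_top_u_le e s) (edist_u_firstLeft_le i .t (e.tip s)) (by lia)

theorem edist_w_firstLeft_le (e : GEdge G) (s : Side) :
    (reductionGraph G).edist (.w e s) (.firstLeft i)
      ≤ (Nat.dist i (e.tip s) * yLen n + 2 * yLen n + 2 * n : ℕ) :=
  edist_le_natCast_of_add_le
    (edist_path_ends_le (Step.spur e s) (by have := two_mul_lt_yLen_half i.pos; lia))
    (edist_top_firstLeft_le i e s) (by lia)

end SkeletonDistances

section GadgetZone

/-- The region around the gadget of `v_k`: the gadget itself, the paths from its anchors to the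
skeleton, and the pieces of the edge gadgets between an end `r^k_j` and the vertex `w` next to it.
The number of steps `m` matters only on these pieces, where it is at least the distance from
`r^k_j`. -/
def gadgetZone (k : Fin n) : Vtx G → ℕ → Prop
  | .anchor _ k', _ => k' = k
  | .anchorInner _ k' _, _ => k' = k
  | .left k' _, _ => k' = k
  | .right k' _, _ => k' = k
  | .edgeInner e p, m => ∃ s, e.tip s = k ∧ e.pos s (p + 1) < yLen n ∧ e.pos s (p + 1) ≤ m
  | _, _ => False

/-- Leaving the region around the gadget of `v_k` at `z` after `m` steps is no shorter for reaching
`v_i` than the way along the skeleton. Here `|i - k| y + 3y/2` is the length of the path of an edge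
gadget between `v_i` and `v_k`. -/
def gadgetExit (i k : Fin n) (z : Vtx G) (m : ℕ) : Prop :=
  (reductionGraph G).edist z (.firstLeft i) ≤ (m + (Nat.dist i k * yLen n + 3 * yLen n / 2) : ℕ)

variable (i k : Fin n)

theorem gadgetZone_edgePoint (e : GEdge G) : ∀ p ≤ e.len, ∀ m,
    gadgetZone k (.edgePoint e p) m ↔ ∃ s, e.tip s = k ∧ e.pos s p < yLen n ∧ e.pos s p ≤ m := by
  have hlen := e.two_mul_yLen_lt_len
  have hy := two_mul_lt_yLen_half k.pos
  refine Vtx.edgePoint_iff e (fun s m => ?_) fun p m => Iff.rfl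
  cases s <;> simp only [Vtx.edgeEnd, gadgetZone, Side.exists, GEdge.pos] <;> lia

theorem not_gadgetZone_w (e : GEdge G) (s : Side) (m : ℕ) : ¬ gadgetZone k (.w e s) m := by
  have hlen := e.two_mul_yLen_lt_len
  rw [Vtx.w, gadgetZone_edgePoint k e _ (e.pos_le s (by lia)), Side.exists]
  cases s <;> simp only [GEdge.pos] <;> lia

theorem not_gadgetZone_top (e : GEdge G) (s : Side) (m : ℕ) : ¬ gadgetZone k (.top e s) m := by
  cases s <;> exact id

theorem advancesOrExits_gadgetZone_anchorPath {c : Line} {k' : Fin n} {x z : Vtx G}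
    (hs : PathStep (.anchor c k') (.u c k') (yLen n) (.anchorInner c k') x z) :
    AdvancesOrExits (gadgetZone k) (gadgetExit i k) x z := by
  have hy := two_mul_lt_yLen_half k.pos
  refine hs.advancesOrExits (fun p _ => k' = k ∧ p < yLen n)
    (pathPoint_iff (fun _ => ?_) (fun _ => ?_) fun p _ => ?_) fun _ q _ hq _ _ ⟨hk, _⟩ => ?_
  · simp only [gadgetZone]
    lia
  · simp [gadgetZone, Vtx.u]
  · simp only [gadgetZone]
    lia
  · rcases hq.lt_or_eq with hlt | rfl
    · exact Or.inl ⟨hk, hlt⟩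
    · refine Or.inr ?_
      rw [pathPoint_len (by lia), hk]
      exact (edist_u_firstLeft_le i c k).trans (mod_cast by lia)

theorem advancesOrExits_gadgetZone_edgePath {e : GEdge G} {x z : Vtx G}
    (hs : PathStep (.right e.i e.j) (.right e.j e.i) e.len (.edgeInner e) x z) :
    AdvancesOrExits (gadgetZone k) (gadgetExit i k) x z := by
  refine hs.advancesOrExits _ (gadgetZone_edgePoint k e) ?_
  rintro p q m hq hpq hqp ⟨s, hk, hlt, hle⟩
  have hstep := e.pos_le_succ s hpq hqp
  rcases Nat.lt_or_ge (e.pos s q) (yLen n) with hq' | hq'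
  · exact Or.inl ⟨s, hk, hq', by lia⟩
  · refine Or.inr ?_
    have hw : Vtx.edgePoint e q = .w e s := by
      rw [Vtx.w, show yLen n = e.pos s q by lia, e.pos_pos s hq]
    have := edist_w_firstLeft_le i e s
    rw [← hw, hk] at this
    have hy := two_mul_lt_yLen_half k.pos
    exact this.trans (mod_cast by lia)

theorem advancesOrExits_gadgetZone {x z : Vtx G} (h : Step G x z) :
    AdvancesOrExits (gadgetZone k) (gadgetExit i k) x z := by
  have spur (e : GEdge G) (s : Side) (hinner : ∀ p m, ¬ gadgetZone k (Vtx.spurInner e s p) m)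
      (hs : PathStep (.w e s) (.top e s) (yLen n) (.spurInner e s) x z) :
      AdvancesOrExits (gadgetZone k) (gadgetExit i k) x z :=
    hs.advancesOrExits_of_not (not_gadgetZone_w k e s) (not_gadgetZone_top k e s) hinner
  cases h with
  | line | leaf => exact advancesOrExits_of_not (fun _ => id) fun _ => id
  | mid c d => cases d <;> exact advancesOrExits_of_not (fun _ => id) fun _ => id
  | anchor c k' x z hs => exact advancesOrExits_gadgetZone_anchorPath i k hs
  | left k' x z hs | right k' x z hs =>
    exact hs.advancesOrExits (fun _ _ => k' = k)
      (pathPoint_iff (fun _ => Iff.rfl) (fun _ => Iff.rfl) fun _ _ => Iff.rfl)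
      fun _ _ _ _ _ _ => Or.inl
  | edge e x z hs => exact advancesOrExits_gadgetZone_edgePath i k hs
  | tl e x z hs => exact spur e .l (fun _ _ => id) hs
  | tr e x z hs => exact spur e .r (fun _ _ => id) hs

theorem edist_firstLeft_le_of_not_gadgetZone (q : Fin n) {x : Vtx G}
    (hx : ∀ m, ¬ gadgetZone k x m) :
    (reductionGraph G).edist x (.firstLeft i) ≤ (reductionGraph G).edist x (.right k q)
      + (Nat.dist i k * yLen n + 3 * yLen n / 2 : ℕ) := by
  by_cases hreach : (reductionGraph G).Reachable x (.right k q)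
  swap
  · simp [SimpleGraph.edist_eq_top_of_not_reachable hreach]
  obtain ⟨p, hp⟩ := hreach.exists_walk_length_eq_edist
  obtain ⟨z, m, hexit, hm⟩ := (reached_or_exists_exit (advancesOrExits_of_adj fun _ _ =>
    advancesOrExits_gadgetZone i k) (show gadgetZone k (.right k q) 0 from rfl) p).resolve_left
    (hx _)
  rw [← hp]
  calc (reductionGraph G).edist x (.firstLeft i)
      ≤ (reductionGraph G).edist x z + (reductionGraph G).edist z (.firstLeft i) :=
        SimpleGraph.edist_triangle
    _ ≤ (reductionGraph G).edist x z + (m + (Nat.dist i k * yLen n + 3 * yLen n / 2) : ℕ) := by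
        gcongr
        exact hexit
    _ = (reductionGraph G).edist x z + m + (Nat.dist i k * yLen n + 3 * yLen n / 2 : ℕ) := by
        rw [Nat.cast_add, add_assoc]
    _ ≤ p.length + (Nat.dist i k * yLen n + 3 * yLen n / 2 : ℕ) := by gcongr

end GadgetZone

section OwnZone

/-- Starting in `r^i_1`, walking along the right half of the cycle to an edge gadget and into it,
one reaches the vertex at position `p` of the path of `e`, and `d` steps further, within `m` steps.
The far end of that path does not count. -/
def GEdge.Reach (e : GEdge G) (i : Fin n) (p d m : ℕ) : Prop :=
  ∃ s, e.tip s = i ∧ e.pos s p < e.len ∧ (e.tip s.opp).val + e.pos s p + d ≤ m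

/-- The vertices that can be reached from `r^i_1` within `m` steps inside the right half of the
cycle and the edge gadgets at `v_i`. -/
def ownZone (i : Fin n) : Vtx G → ℕ → Prop
  | .right k q, m => k = i ∧ q.val ≤ m
  | .edgeInner e p, m => e.Reach i (p + 1) 0 m
  | .tlInner e p, m => e.Reach i (e.pos .l (yLen n)) (p + 1) m
  | .trInner e p, m => e.Reach i (e.pos .r (yLen n)) (p + 1) m
  | _, _ => False

/-- The two ways to leave `ownZone i` at `z` after `m` steps: either `l^i_1` is no farther from `z`
than `r^i_1`, or `z` is the far end of an edge gadget. -/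
def ownExit (i : Fin n) (z : Vtx G) (m : ℕ) : Prop :=
  (reductionGraph G).edist z (.firstLeft i) ≤ m ∨
    ∃ k q, G.Adj i k ∧ z = .right k q ∧ Nat.dist i k * yLen n + 3 * yLen n / 2 ≤ m

variable (i : Fin n)

theorem ownZone_edgePoint (e : GEdge G) : ∀ p ≤ e.len, ∀ m,
    ownZone i (.edgePoint e p) m ↔ e.Reach i p 0 m := by
  have hlen := e.two_mul_yLen_lt_len
  refine Vtx.edgePoint_iff e (fun s m => ?_) fun p m => Iff.rfl
  cases s <;> simp only [Vtx.edgeEnd, ownZone, GEdge.Reach, Side.exists, GEdge.pos, Side.opp] <;>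
    lia

theorem ownZone_w (e : GEdge G) (s : Side) (m : ℕ) :
    ownZone i (.w e s) m ↔ e.Reach i (e.pos s (yLen n)) 0 m :=
  ownZone_edgePoint i e _ (e.pos_le s (by have := e.two_mul_yLen_lt_len; lia)) m

theorem not_ownZone_top (e : GEdge G) (s : Side) (m : ℕ) : ¬ ownZone i (.top e s) m := by
  cases s <;> exact id

theorem ownZone_spurInner (e : GEdge G) (s : Side) (p : Fin (yLen n - 1)) (m : ℕ) :
    ownZone i (.spurInner e s p) m ↔ e.Reach i (e.pos s (yLen n)) (p + 1) m := by
  cases s <;> rfl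

theorem edist_top_firstLeft_le_of_reach (e : GEdge G) (s : Side) {m : ℕ}
    (h : e.Reach i (e.pos s (yLen n)) (yLen n) m) :
    (reductionGraph G).edist (.top e s) (.firstLeft i) ≤ m := by
  have hlen := e.two_mul_yLen_lt_len
  have hy := two_mul_lt_yLen_half i.pos
  refine (edist_top_firstLeft_le i e s).trans (Nat.cast_le.2 ?_)
  obtain ⟨s', rfl, -, hle⟩ := h
  have := e.len_eq s'
  cases s <;> cases s' <;> simp only [GEdge.pos, Side.opp, Nat.dist_self] at hle this ⊢ <;> lia

theorem advancesOrExits_ownZone_rightPath {k : Fin n} {x z : Vtx G}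
    (hs : PathStep (.anchor .t k) (.anchor .b k) (n + 1) (.right k) x z) :
    AdvancesOrExits (ownZone i) (ownExit i) x z := by
  refine hs.advancesOrExits (fun p m => k = i ∧ 1 ≤ p ∧ p ≤ n ∧ p ≤ m + 1)
    (pathPoint_iff (fun m => ?_) (fun m => ?_) fun p m => ?_)
    fun p q m hq _ _ ⟨hk, _, hpn, hpm⟩ => ?_
  · simp [ownZone]
  · simp [ownZone]
  · simp only [ownZone]
    lia
  · subst hk
    rcases Nat.eq_zero_or_pos q with rfl | hpos
    · refine Or.inr (Or.inl ?_)
      rw [pathPoint_zero]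
      exact (edist_anchor_t_firstLeft_le k).trans (mod_cast by lia)
    · rcases hq.lt_or_eq with hlt | rfl
      · exact Or.inl ⟨rfl, hpos, by lia, by lia⟩
      · refine Or.inr (Or.inl ?_)
        rw [pathPoint_len (by lia)]
        exact (edist_anchor_b_firstLeft_le k).trans (mod_cast by lia)

theorem advancesOrExits_ownZone_edgePath {e : GEdge G} {x z : Vtx G}
    (hs : PathStep (.right e.i e.j) (.right e.j e.i) e.len (.edgeInner e) x z) :
    AdvancesOrExits (ownZone i) (ownExit i) x z := by
  refine hs.advancesOrExits _ (ownZone_edgePoint i e) ?_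
  rintro p q m hq hpq hqp ⟨s, rfl, -, hle⟩
  have hstep := e.pos_le_succ s hpq hqp
  rcases (e.pos_le s hq).lt_or_eq with hlt | hlen
  · exact Or.inl ⟨s, rfl, hlt, by lia⟩
  · have hend : Vtx.edgePoint e q = .edgeEnd e s.opp := by
      rw [← Vtx.edgePoint_pos_len, ← hlen, e.pos_pos s hq]
    have := e.len_eq s
    exact Or.inr (Or.inr ⟨e.tip s.opp, e.tip s.opp.opp, e.adj_tip s, hend, by lia⟩)

theorem advancesOrExits_ownZone_spur {e : GEdge G} (s : Side) {x z : Vtx G}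
    (hs : PathStep (.w e s) (.top e s) (yLen n) (.spurInner e s) x z) :
    AdvancesOrExits (ownZone i) (ownExit i) x z := by
  have hy := two_mul_lt_yLen_half i.pos
  refine hs.advancesOrExits (fun p m => p < yLen n ∧ e.Reach i (e.pos s (yLen n)) p m)
    (pathPoint_iff (fun m => ?_) (fun m => ?_) fun p m => ?_) ?_
  · simp only [ownZone_w, show 0 < yLen n by lia, true_and]
  · simp only [not_ownZone_top, lt_irrefl, false_and]
  · simp only [ownZone_spurInner, show p.val + 1 < yLen n by lia, true_and]
  · rintro p q m hq hpq hqp ⟨-, s', hi, hpos, hle⟩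
    have hreach : e.Reach i (e.pos s (yLen n)) q (m + 1) := ⟨s', hi, hpos, by lia⟩
    rcases hq.lt_or_eq with hlt | rfl
    · exact Or.inl ⟨hlt, hreach⟩
    · refine Or.inr (Or.inl ?_)
      rw [pathPoint_len (by lia)]
      exact edist_top_firstLeft_le_of_reach i e s hreach

theorem advancesOrExits_ownZone {x z : Vtx G} (h : Step G x z) :
    AdvancesOrExits (ownZone i) (ownExit i) x z := by
  cases h with
  | line | leaf => exact advancesOrExits_of_not (fun _ => id) fun _ => id
  | mid c d => cases d <;> exact advancesOrExits_of_not (fun _ => id) fun _ => id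
  | anchor c k x z hs | left k x z hs =>
    exact hs.advancesOrExits_of_not (fun _ => id) (fun _ => id) fun _ _ => id
  | right k x z hs => exact advancesOrExits_ownZone_rightPath i hs
  | edge e x z hs => exact advancesOrExits_ownZone_edgePath i hs
  | tl e x z hs => exact advancesOrExits_ownZone_spur i .l hs
  | tr e x z hs => exact advancesOrExits_ownZone_spur i .r hs

end OwnZone

section Folding

/-- Fold the left half of the cycle of `v_k` onto the right half for every `k` with `P k`, and move
the two leaves of each `P₃` by `σ`. -/
def fold (P : Fin n → Bool) (σ : Line → Side → Bool → Bool) : Vtx G → Vtx G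
  | .left k q => if P k then .right k q else .left k q
  | .leaf c d m => .leaf c d (σ c d m)
  | x => x

variable (P : Fin n → Bool) (σ : Line → Side → Bool → Bool)

theorem fold_edgePoint (e : GEdge G) (p : ℕ) : fold P σ (.edgePoint e p) = .edgePoint e p :=
  map_pathPoint _ _

theorem step_fold {x z : Vtx G} (h : Step G x z) : Step G (fold P σ x) (fold P σ z) := by
  cases h with
  | line c p q hpq => exact .line c p q hpq
  | mid c d => cases d; exacts [.mid c .l, .mid c .r]
  | leaf c d m => exact .leaf c d (σ c d m)
  | anchor c k x z hs => exact .anchor c k _ _ (hs.map _)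
  | left k x z hs =>
    have hs' := hs.map (fold P σ)
    cases hk : P k
    · exact .left k _ _ (by simpa [Function.comp_def, fold, hk] using hs')
    · exact .right k _ _ (by simpa [Function.comp_def, fold, hk] using hs')
  | right k x z hs => exact .right k _ _ (hs.map _)
  | edge e x z hs => exact .edge e _ _ (hs.map _)
  | tl e x z hs =>
    have hs' := hs.map (fold P σ)
    rw [Vtx.w1, fold_edgePoint] at hs'
    exact .tl e _ _ hs'
  | tr e x z hs =>
    have hs' := hs.map (fold P σ)
    rw [Vtx.w2, fold_edgePoint] at hs'
    exact .tr e _ _ hs'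

theorem edist_fold_le (x a : Vtx G) :
    (reductionGraph G).edist (fold P σ x) (fold P σ a) ≤ (reductionGraph G).edist x a :=
  edist_map_le_of_step (fun _ _ => step_fold P σ) x a

theorem edist_firstRight_le_edist_firstLeft {i : Fin n} {x : Vtx G} (hx : ∀ q, x ≠ .left i q) :
    (reductionGraph G).edist x (.firstRight i) ≤ (reductionGraph G).edist x (.firstLeft i) := by
  have hfix : fold (fun k => k = i) (fun _ _ => id) x = x := by
    cases x with
    | left k q =>
      have hk : k ≠ i := fun hk => hx q (hk ▸ rfl)
      simp [fold, hk]
    | _ => rfl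
  have h := edist_fold_le (fun k => k = i) (fun _ _ => id) x (.firstLeft i)
  rw [hfix] at h
  simpa [fold, Vtx.firstLeft, Vtx.firstRight] using h

theorem edist_leaf_not_le {c : Line} {d : Side} {x : Vtx G} (hx : ∀ m, x ≠ .leaf c d m) (m : Bool) :
    (reductionGraph G).edist x (.leaf c d !m) ≤ (reductionGraph G).edist x (.leaf c d m) := by
  classical
  let swap : Line → Side → Bool → Bool := fun c' d' m' => if c' = c ∧ d' = d then !m' else m'
  have hfix : fold (fun _ => false) swap x = x := by
    cases x with
    | leaf c' d' m' =>
      have hne : ¬ (c' = c ∧ d' = d) := by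
        rintro ⟨rfl, rfl⟩
        exact hx m' rfl
      simp [fold, swap, hne]
    | _ => rfl
  have h := edist_fold_le (fun _ => false) swap x (.leaf c d m)
  rw [hfix] at h
  simpa [fold, swap] using h

theorem IsMetricBasis.exists_leaf_mem {L : Finset (Vtx G)}
    (hL : IsMetricBasis (reductionGraph G) L) (c : Line) (d : Side) : ∃ m, .leaf c d m ∈ L := by
  obtain ⟨x, hxL, hx⟩ := hL (.leaf c d true) (.leaf c d false) (by simp)
  by_contra! hleaf
  have hne (m : Bool) : x ≠ .leaf c d m := fun h => hleaf m (h ▸ hxL)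
  exact hx <| dist_eq_of_edist_eq <|
    (edist_leaf_not_le hne false).antisymm (edist_leaf_not_le hne true)

end Folding

section DominatingSet

/-- The vertex `v_k` of `G` to which a vertex of `G'` is charged: the one whose vertex gadget, or
a path from it to the skeleton, contains the vertex. Vertices of an edge gadget are charged to an
end of the edge, namely to `v_i` if they are closer than `yLen n` to `r^i_j` along its path. The
vertices of the skeleton are not charged. -/
def home : Vtx G → Option (Fin n)
  | .anchor _ k => some k
  | .anchorInner _ k _ => some k
  | .left k _ => some k
  | .right k _ => some k
  | .edgeInner e p => if p.val + 1 < yLen n then some e.i else some e.j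
  | .tlInner e _ => some e.i
  | .trInner e _ => some e.i
  | _ => none

theorem home_eq_of_gadgetZone {k : Fin n} {x : Vtx G} {m : ℕ} (h : gadgetZone k x m) :
    home x = some k := by
  cases x with
  | line | mid | leaf | tlInner | trInner => exact h.elim
  | anchor | anchorInner | left | right => exact congrArg some h
  | edgeInner e p =>
    have hlen := e.two_mul_yLen_lt_len
    obtain ⟨s, rfl, hpos, -⟩ := h
    cases s
    · exact if_pos hpos
    · exact if_neg (by simp only [GEdge.pos] at hpos; lia)

theorem GEdge.Reach.eq_or_adj {e : GEdge G} {i : Fin n} {p d m : ℕ} (h : e.Reach i p d m)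
    (s : Side) : e.tip s = i ∨ G.Adj i (e.tip s) := by
  obtain ⟨s', rfl, -⟩ := h
  cases s <;> cases s'
  exacts [.inl rfl, .inr (e.adj_tip .r), .inr (e.adj_tip .l), .inl rfl]

theorem exists_home_eq_of_ownZone {i : Fin n} {x : Vtx G} {m : ℕ} (h : ownZone i x m) :
    ∃ k, home x = some k ∧ (k = i ∨ G.Adj i k) := by
  cases x with
  | line | mid | leaf | anchor | anchorInner | left => exact h.elim
  | right k q => exact ⟨k, rfl, .inl h.1⟩
  | edgeInner e p =>
    rw [home]
    split_ifs
    exacts [⟨e.i, rfl, h.eq_or_adj .l⟩, ⟨e.j, rfl, h.eq_or_adj .r⟩]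
  | tlInner e p | trInner e p => exact ⟨e.i, rfl, GEdge.Reach.eq_or_adj h .l⟩

theorem exists_home_eq_of_edist_lt {i : Fin n} {x : Vtx G}
    (h : (reductionGraph G).edist x (.firstRight i) < (reductionGraph G).edist x (.firstLeft i)) :
    ∃ k, home x = some k ∧ (k = i ∨ G.Adj i k) := by
  obtain ⟨p, hp⟩ := (SimpleGraph.edist_ne_top_iff_reachable.1 h.ne_top).exists_walk_length_eq_edist
  rcases reached_or_exists_exit (advancesOrExits_of_adj fun _ _ => advancesOrExits_ownZone i)
    (show ownZone i (.firstRight i) 0 from ⟨rfl, le_rfl⟩) p with hx | ⟨z, m, hexit, hm⟩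
  · exact exists_home_eq_of_ownZone hx
  · suffices hz : ∃ k q, G.Adj i k ∧ z = .right k q ∧ Nat.dist i k * yLen n + 3 * yLen n / 2 ≤ m by
      obtain ⟨k, q, hadj, rfl, hle⟩ := hz
      refine ⟨k, ?_, .inr hadj⟩
      by_contra hhome
      refine h.not_ge ?_
      calc (reductionGraph G).edist x (.firstLeft i)
          ≤ (reductionGraph G).edist x (.right k q)
            + (Nat.dist i k * yLen n + 3 * yLen n / 2 : ℕ) :=
            edist_firstLeft_le_of_not_gadgetZone i k q fun m' hx =>
              hhome (home_eq_of_gadgetZone hx)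
        _ ≤ (reductionGraph G).edist x (.right k q) + m := by gcongr
        _ ≤ (reductionGraph G).edist x (.firstRight i) := hp ▸ hm
    refine hexit.resolve_left fun hz => h.not_ge ?_
    calc (reductionGraph G).edist x (.firstLeft i)
        ≤ (reductionGraph G).edist x z + (reductionGraph G).edist z (.firstLeft i) :=
          SimpleGraph.edist_triangle
      _ ≤ (reductionGraph G).edist x z + m := by gcongr
      _ ≤ (reductionGraph G).edist x (.firstRight i) := hp ▸ hm

theorem exists_home_eq_of_dist_ne {i : Fin n} {x : Vtx G}
    (h : (reductionGraph G).dist x (.firstLeft i) ≠ (reductionGraph G).dist x (.firstRight i)) :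
    ∃ k, home x = some k ∧ (k = i ∨ G.Adj i k) := by
  by_cases hx : ∃ q, x = .left i q
  · obtain ⟨q, rfl⟩ := hx
    exact ⟨i, rfl, .inl rfl⟩
  · push Not at hx
    exact exists_home_eq_of_edist_lt <| (edist_firstRight_le_edist_firstLeft hx).lt_of_ne
      fun heq => h (dist_eq_of_edist_eq heq.symm)

theorem IsMetricBasis.exists_four_leaves {L : Finset (Vtx G)}
    (hL : IsMetricBasis (reductionGraph G) L) :
    ∃ T ⊆ L, T.card = 4 ∧ ∀ x ∈ T, home x = none := by
  classical
  choose m hm using hL.exists_leaf_mem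
  refine ⟨{.leaf .t .l (m .t .l), .leaf .t .r (m .t .r), .leaf .b .l (m .b .l),
    .leaf .b .r (m .b .r)}, ?_, by simp, by simp [home]⟩
  simp [Finset.insert_subset_iff, hm]

theorem dominatingSetYes_of_metricDimensionYes {h : ℕ}
    (hyes : MetricDimensionYes (reductionGraph G) (h + 4)) : DominatingSetYes G h := by
  classical
  obtain ⟨L, hcard, hL⟩ := hyes
  obtain ⟨T, hTL, hT, hhome⟩ := hL.exists_four_leaves
  refine ⟨Finset.eraseNone ((L \ T).image home), ?_, fun i => ?_⟩
  · have himage := (Finset.card_eraseNone_le (s := (L \ T).image home)).trans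
      Finset.card_image_le
    rw [Finset.card_sdiff_of_subset hTL] at himage
    lia
  · obtain ⟨x, hxL, hx⟩ := hL (.firstLeft i) (.firstRight i) nofun
    obtain ⟨k, hk, hik⟩ := exists_home_eq_of_dist_ne hx
    have hxT : x ∉ T := fun hxT => by simp [hhome x hxT] at hk
    refine ⟨k, ?_, hik⟩
    rw [Finset.mem_eraseNone, ← hk]
    exact Finset.mem_image_of_mem home (Finset.mem_sdiff.2 ⟨hxL, hxT⟩)

end DominatingSet

theorem DominatingSetYes.of_comap {V : Type*} {G : SimpleGraph V} {ι : Type*} (v : ι ≃ V) {h : ℕ}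
    (hyes : DominatingSetYes (G.comap v) h) : DominatingSetYes G h := by
  obtain ⟨D, hcard, hD⟩ := hyes
  refine ⟨D.map v.toEmbedding, by rwa [Finset.card_map], fun x => ?_⟩
  obtain ⟨d, hdD, hd⟩ := hD (v.symm x)
  refine ⟨v d, Finset.mem_map_of_mem _ hdD, ?_⟩
  simpa [Equiv.eq_symm_apply] using hd

end MetricDim

theorem mainTheorem4_general {V : Type*} (G : SimpleGraph V) {n : ℕ} (v : Fin n ≃ V) {h : ℕ}
    (hyes : MetricDim.MetricDimensionYes (MetricDim.reductionGraph (G.comap v)) (h + 4)) :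
    MetricDim.DominatingSetYes G h :=
  .of_comap v (MetricDim.dominatingSetYes_of_metricDimensionYes hyes)

theorem mainTheorem4 {V : Type*} (G : SimpleGraph V) (V₁ V₂ : Set V)
    (hG : G.IsBipartiteWith V₁ V₂)
    (n s : ℕ) (v : Fin n ≃ V)
    (hV₁ : V₁ = {x | ∃ i : Fin n, i.val < s ∧ v i = x})
    (hV₂ : V₂ = {x | ∃ i : Fin n, s ≤ i.val ∧ v i = x})
    (hgap : ∀ i j : Fin n, i < j → G.Adj (v i) (v j) → i.val + 3 ≤ j.val)
    (h : ℕ) (hh : 1 ≤ h)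
    (hyes : MetricDim.MetricDimensionYes (MetricDim.reductionGraph (G.comap v)) (h + 4)) :
    MetricDim.DominatingSetYes G h := by
  exact mainTheorem4_general G v hyes
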